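/- Let $n\ge 3$ and let $\Gamma(t)\subset\mathbb R^n$, $t>0$, be an evolving hypersurface such that each $\Gamma(t)$ is a closed (compact, without boundary), simply connected, embedded $(n-1)$-dimensional manifold of class $C^3$, and such that the space-time set $\mathcal G=\bigcup_{t>0}\Gamma(t)\times\{t\}$ is an $n$-dimensional embedded $C^2$ submanifold of $\mathbb R^{n+1}$. Let $\mathbf n=\mathbf n(x,t)$ be the outward unit normal of $\Gamma(t)$ and $\mathbf P=\mathbf I-\mathbf n\mathbf n^T$. Let $\mathbf u(\cdot,t):\mathbb R^n\to\mathbb R^n$ be a velocity field, differentiable in $x$ at the points of $\Gamma(t)$, such that $V_\Gamma=\mathbf u\cdot\mathbf n$ on $\mathcal G$, where $V_\Gamma$ is the normal velocity of $\Gamma$: at $x\in\Gamma(t)$, $V_\Gamma=\gamma'(t)\cdot\mathbf n$ for a curve $\gamma$, differentiable at $t$, with $\gamma(s)\in\Gamma(s)$ for $s$ near $t$ and $\gamma(t)=x$ (in particular such a curve is assumed to exist). Put $\mathbf u_T=\mathbf P\mathbf u$ and $u_N=\mathbf u\cdot\mathbf n$. Here $\nabla$ is the Fréchet derivative in $x$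 (a row vector for scalar functions) and $\nabla^T$ its transpose. For a scalar function $f$ and a vector field $\mathbf v$ on $\Gamma(t)$ put $\nabla_\Gamma f=(\nabla f)\mathbf P$, $\nabla_\Gamma^Tf=(\nabla_\Gamma f)^T$ and $\nabla_\Gamma\mathbf v=\mathbf P(\nabla\mathbf v)\mathbf P$; let $\mathbf H=\nabla_\Gamma\mathbf n$ be the Weingarten map. For a (scalar, vector or matrix valued) function $f$ on $\mathcal G$ the material derivative is $\dot f=\frac{\partial f}{\partial t}+(\nabla f)\mathbf u$. When $f$ or $\mathbf v$ is given on the surface only, these derivatives are computed from an extension to the ambient space that is differentiable at the point considered. Then, at every point of $\Gamma(t)$, $t>0$, such extensions of $\mathbf n$, $u_N$ and $\mathbf P$ exist, the derivatives $\mathbf H$, $\nabla_\Gamma^Tu_N$, $\dot{\mathbf n}$ and $\dot{\mathbf P}$ do not depend on the choice of the extensions, and $$\dot{\mathbf n}=\mathbf H\mathbf u_T-\nabla_\Gamma^Tu_N=-\mathbf P(\nabla^T\mathbf u)\mathbf n,\qquad \dot{\mathbf P}=\mathbf P(\nabla^T\mathbf u)(\mathbf I-\mathbf P)+(\mathbf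 I-\mathbf P)(\nabla\mathbf u)\mathbf P .$$ -/

import Mathlib

open Set Filter Topology

/-- `S` is an embedded hypersurface of class `C^k`: near each of its points it is the zero set of
a `C^k` function whose differential does not vanish at that point. -/
def IsHypersurface {X : Type*} [NormedAddCommGroup X] [NormedSpace ℝ X] (k : ℕ) (S : Set X) :
    Prop :=
  ∀ p ∈ S, ∃ U : Set X, IsOpen U ∧ p ∈ U ∧ ∃ φ : X → ℝ,
    ContDiffOn ℝ k φ U ∧ fderiv ℝ φ p ≠ 0 ∧ S ∩ U = {q ∈ U | φ q = 0}

/-- The space-time set `⋃_{t > 0} Γ(t) × {t}`. -/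
def spaceTime {n : ℕ} (Γ : ℝ → Set (EuclideanSpace ℝ (Fin n))) :
    Set (EuclideanSpace ℝ (Fin n) × ℝ) :=
  {p | 0 < p.2 ∧ p.1 ∈ Γ p.2}

/-- A closed (compact, without boundary), simply connected evolving hypersurface of `ℝⁿ`: each
`Γ(t)` is of class `C³` and the space-time manifold is of class `C²`. -/
structure IsEvolvingSurface {n : ℕ} (Γ : ℝ → Set (EuclideanSpace ℝ (Fin n))) : Prop where
  isCompact : ∀ t, 0 < t → IsCompact (Γ t)
  simplyConnected : ∀ t, 0 < t → SimplyConnectedSpace (Γ t)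
  hypersurface : ∀ t, 0 < t → IsHypersurface 3 (Γ t)
  spaceTime_hypersurface : IsHypersurface 2 (spaceTime Γ)

/-- The region enclosed by `S`: the union of the bounded connected components of the complement. -/
def enclosedRegion {n : ℕ} (S : Set (EuclideanSpace ℝ (Fin n))) :
    Set (EuclideanSpace ℝ (Fin n)) :=
  {y | y ∉ S ∧ Bornology.IsBounded (connectedComponentIn Sᶜ y)}

/-- `ν` is the outward pointing unit normal of the closed hypersurface `S` at `x ∈ S`. -/
structure IsOutwardUnitNormal {n : ℕ} (S : Set (EuclideanSpace ℝ (Fin n)))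
    (x ν : EuclideanSpace ℝ (Fin n)) : Prop where
  norm_eq_one : ‖ν‖ = 1
  orthogonal : ∀ v ∈ tangentConeAt ℝ S x, inner ℝ ν v = 0
  inward_side : ∀ᶠ δ : ℝ in 𝓝[>] 0, x - δ • ν ∈ enclosedRegion S
  outward_side : ∀ᶠ δ : ℝ in 𝓝[>] 0, x + δ • ν ∉ S ∪ enclosedRegion S

/-- The evolving surface `Γ` has normal velocity `V`, in the direction of the unit normal `ν`,
at `x ∈ Γ(t)`: `V` is the normal component of the velocity at time `t` of a curve
`s ↦ γ(s) ∈ Γ(s)` through `x` at time `t`. -/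
def HasNormalVelocity {n : ℕ} (Γ : ℝ → Set (EuclideanSpace ℝ (Fin n)))
    (x : EuclideanSpace ℝ (Fin n)) (t : ℝ) (ν : EuclideanSpace ℝ (Fin n)) (V : ℝ) : Prop :=
  ∃ γ : ℝ → EuclideanSpace ℝ (Fin n), γ t = x ∧ (∀ᶠ s in 𝓝 t, γ s ∈ Γ s) ∧
    DifferentiableAt ℝ γ t ∧ inner ℝ (deriv γ t) ν = V

/-- The projector `I - ν νᵀ`. -/
noncomputable def normalProjector {n : ℕ} (ν : EuclideanSpace ℝ (Fin n)) :
    EuclideanSpace ℝ (Fin n) →L[ℝ] EuclideanSpace ℝ (Fin n) :=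
  ContinuousLinearMap.id ℝ _ - (innerSL ℝ ν).smulRight ν

/-- `F` is a function on the ambient space that is differentiable at `p` and coincides, near `p`,
with `f` on `S`. -/
def IsExtensionAt {X W : Type*} [NormedAddCommGroup X] [NormedSpace ℝ X]
    [NormedAddCommGroup W] [NormedSpace ℝ W] (S : Set X) (f : X → W) (p : X) (F : X → W) : Prop :=
  DifferentiableAt ℝ F p ∧ ∀ᶠ q in 𝓝[S] p, F q = f q

/-- `∂F/∂t + (∇F) u` for a function `F` of space and time. -/
noncomputable def ambientMaterialDeriv {n : ℕ} {W : Type*} [NormedAddCommGroup W]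
    [NormedSpace ℝ W] (u : EuclideanSpace ℝ (Fin n) → ℝ → EuclideanSpace ℝ (Fin n))
    (F : EuclideanSpace ℝ (Fin n) × ℝ → W) (x : EuclideanSpace ℝ (Fin n)) (t : ℝ) : W :=
  deriv (fun s => F (x, s)) t + fderiv ℝ (fun y => F (y, t)) x (u x t)

/-- The function `f` on the space-time manifold has material derivative `w` at `(x, t)`:
differentiable extensions exist, and all of them give the value `w`. -/
def HasMaterialDeriv {n : ℕ} {W : Type*} [NormedAddCommGroup W] [NormedSpace ℝ W]
    (Γ : ℝ → Set (EuclideanSpace ℝ (Fin n)))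
    (u : EuclideanSpace ℝ (Fin n) → ℝ → EuclideanSpace ℝ (Fin n))
    (f : EuclideanSpace ℝ (Fin n) → ℝ → W) (x : EuclideanSpace ℝ (Fin n)) (t : ℝ) (w : W) :
    Prop :=
  (∃ F, IsExtensionAt (spaceTime Γ) (fun p => f p.1 p.2) (x, t) F) ∧
    ∀ F, IsExtensionAt (spaceTime Γ) (fun p => f p.1 p.2) (x, t) F →
      ambientMaterialDeriv u F x t = w

/-- The scalar function `f` on the hypersurface `S`, with unit normal `ν` at `x`, has the column
tangential gradient `∇_Γᵀ f = ((∇f) P)ᵀ = P ∇ᵀf` equal to `a` at `x`: differentiable extensions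
exist, and all of them give the value `a`. -/
def HasTangentialGradient {n : ℕ} (S : Set (EuclideanSpace ℝ (Fin n)))
    (f : EuclideanSpace ℝ (Fin n) → ℝ) (x ν a : EuclideanSpace ℝ (Fin n)) : Prop :=
  (∃ F, IsExtensionAt S f x F) ∧
    ∀ F, IsExtensionAt S f x F → normalProjector ν (gradient F x) = a

/-- The vector field `f` on the hypersurface `S`, with unit normal `ν` at `x`, has the covariant
derivative `∇_Γ f = P (∇f) P` equal to `A` at `x`: differentiable extensions exist, and all of
them give the value `A`. -/
def HasCovariantDeriv {n : ℕ} (S : Set (EuclideanSpace ℝ (Fin n)))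
    (f : EuclideanSpace ℝ (Fin n) → EuclideanSpace ℝ (Fin n)) (x ν : EuclideanSpace ℝ (Fin n))
    (A : EuclideanSpace ℝ (Fin n) →L[ℝ] EuclideanSpace ℝ (Fin n)) : Prop :=
  (∃ F, IsExtensionAt S f x F) ∧
    ∀ F, IsExtensionAt S f x F → normalProjector ν ∘L fderiv ℝ F x ∘L normalProjector ν = A

/-!
Near a point `(x, t)` of the space-time manifold `G`, write `G = {φ = 0}` with `φ` of class `C²`,
and let `g` be the gradient of `φ` in the space variable. A curve `s ↦ (γ s, s)` in `G` gives
`dφ (γ', 1) = 0`, so `g = 0` would force `dφ = 0`; hence `g ≠ 0` and `m = g / ‖g‖` is a `C¹`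
field near `(x, t)`. Up to the sign of `φ`, this `m` extends the outward normal `ν`.

That `ν = ± m` on `G` is linear algebra, since the tangent cone of `{φ = 0}` contains the kernel of
the differential (`mem_tangentConeAt_of_fderiv_eq_zero`). That the sign is locally constant in space
and time is a global fact. As `Γ s` is connected and meets every neighbourhood of `Γ t` for `s` near
`t`, it is contained in any given such neighbourhood (`IsEvolvingSurface.eventually_subset`). So a
point `z` which a path avoiding `Γ t` joins to infinity is still joined to infinity when the surface
moves a little (`IsEvolvingSurface.eventually_notMem_enclosedRegion`). If the sign jumped at
`(y, s)`, points just above `y`, where `φ > 0`, would be enclosed by `Γ s`; moving them in the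
direction `m (x, t)`, along which `φ` increases, would reach a point near `x + δ m (x, t)` without
crossing `Γ s`, and such a point is not enclosed
(`IsLocalDefiningFunction.eventually_eq_unitGradient`).

Two differentiable extensions have the same derivative on the tangent cone, which contains the
range of `P` and the vector `(u, 1)`; this makes all four derivatives independent of the extension.
The normal velocity condition reads `dφ (u, 1) = 0` on `G`. Differentiating it in a direction
`w` tangent to `Γ t`, and using the symmetry of `D²φ`, gives
`⟪Dm (u, 1), w⟫ = -⟪m, (∇u) w⟫`
(`IsLocalDefiningFunction.inner_fderiv_unitGradient_velocity`), that is, the second expression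
for the material derivative of `ν`. The first one follows from the product rule for `⟪u, m⟫` and
the symmetry of the Weingarten map
(`IsLocalDefiningFunction.inner_fderiv_unitGradient_comm`), and the formula for the derivative of
`P = I - m mᵀ` from the product rule.
-/

/-! ### Stability of the enclosed region in time -/

/-- A hypersurface is relatively closed in a neighbourhood of each of its points.
It need not be a closed set. -/
theorem IsHypersurface.eventually_notMem {X : Type*} [NormedAddCommGroup X] [NormedSpace ℝ X]
    {k : ℕ} {S : Set X} (hS : IsHypersurface k S) {p : X} (hp : p ∈ S) :
    ∀ᶠ q in 𝓝 p, q ∉ S → ∀ᶠ r in 𝓝 q, r ∉ S := by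
  obtain ⟨U, hU, hpU, φ, hφ, -, hSU⟩ := hS p hp
  filter_upwards [hU.mem_nhds hpU] with q hq hqS
  have hφq : φ q ≠ 0 := fun h0 =>
    hqS (hSU.ge (show q ∈ {q ∈ U | φ q = 0} from ⟨hq, h0⟩)).1
  have hc : ContinuousAt φ q := hφ.continuousOn.continuousAt (hU.mem_nhds hq)
  filter_upwards [hU.mem_nhds hq, hc.eventually_ne hφq] with r hrU hr hrS
  have : r ∈ S ∩ U := ⟨hrS, hrU⟩
  rw [hSU] at this
  exact hr this.2

theorem IsEvolvingSurface.isPreconnected {n : ℕ} {Γ : ℝ → Set (EuclideanSpace ℝ (Fin n))}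
    (hΓ : IsEvolvingSurface Γ) {t : ℝ} (ht : 0 < t) : IsPreconnected (Γ t) := by
  have := hΓ.simplyConnected t ht
  exact isPreconnected_iff_preconnectedSpace.2 inferInstance

/-- Compactness of `Γ t` confines `Γ s` away from the boundary of a small neighbourhood `V` of
`Γ t`, and `Γ s` is connected with the point `γ s` in `V`, so that no part of it can lie outside. -/
theorem IsEvolvingSurface.eventually_subset {n : ℕ} {Γ : ℝ → Set (EuclideanSpace ℝ (Fin n))}
    (hΓ : IsEvolvingSurface Γ) {t : ℝ} (ht : 0 < t) {γ : ℝ → EuclideanSpace ℝ (Fin n)}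
    (hγ : ∀ᶠ s in 𝓝 t, γ s ∈ Γ s) (hγc : ContinuousAt γ t)
    {N : Set (EuclideanSpace ℝ (Fin n))} (hN : IsOpen N) (hΓN : Γ t ⊆ N) :
    ∀ᶠ s in 𝓝 t, Γ s ⊆ N := by
  -- `A` consists of the points at time `t` near which the space-time set is relatively closed
  set A : Set (EuclideanSpace ℝ (Fin n)) :=
    {y | ∀ᶠ q in 𝓝 (y, t), q ∉ spaceTime Γ → ∀ᶠ r in 𝓝 q, r ∉ spaceTime Γ} with hA
  have hAo : IsOpen A := by
    have : Continuous fun y : EuclideanSpace ℝ (Fin n) => (y, t) := by fun_prop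
    exact (isOpen_setOfPred_eventually_nhds (p := fun q =>
      q ∉ spaceTime Γ → ∀ᶠ r in 𝓝 q, r ∉ spaceTime Γ)).preimage this
  have hΓA : Γ t ⊆ A := fun y hy =>
    hΓ.spaceTime_hypersurface.eventually_notMem (p := (y, t)) ⟨ht, hy⟩
  obtain ⟨V, hV, hΓV, hVN, hVc⟩ := exists_open_between_and_isCompact_closure
    (hΓ.isCompact t ht) (hN.inter hAo) (subset_inter hΓN hΓA)
  have hK : IsCompact (frontier V) := hVc.of_isClosed_subset isClosed_frontier frontier_subset_closure
  have hfr : ∀ᶠ s in 𝓝 t, ∀ y ∈ frontier V, (y, s) ∉ spaceTime Γ := by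
    refine hK.eventually_forall_of_forall_eventually (P := fun s y => (y, s) ∉ spaceTime Γ) ?_
    intro y hy
    have hyV : y ∉ Γ t := fun h => (hV.frontier_eq ▸ hy).2 (hΓV h)
    have h1 : ∀ᶠ q in 𝓝 (y, t), q ∉ spaceTime Γ :=
      ((hVN (frontier_subset_closure hy)).2).self_of_nhds fun h => hyV h.2
    exact (continuous_swap.tendsto (t, y)).eventually h1
  have hγV : ∀ᶠ s in 𝓝 t, γ s ∈ V := by
    have : γ t ∈ V := hΓV hγ.self_of_nhds
    exact hγc.eventually (hV.mem_nhds this)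
  filter_upwards [hfr, hγV, hγ, lt_mem_nhds ht] with s h1 h2 h3 h4
  refine Subset.trans ?_ (subset_closure.trans (hVN.trans inter_subset_left))
  refine (hΓ.isPreconnected h4).subset_left_of_subset_union hV isClosed_closure.isOpen_compl
    (disjoint_compl_right.mono_left subset_closure) ?_ ⟨γ s, h3, h2⟩
  intro y hy
  by_cases hyV : y ∈ V
  · exact Or.inl hyV
  · refine Or.inr fun hyc => h1 y ?_ ⟨h4, hy⟩
    rw [hV.frontier_eq]
    exact ⟨hyc, hyV⟩

theorem mem_enclosedRegion_of_isPreconnected {n : ℕ} {S K : Set (EuclideanSpace ℝ (Fin n))}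
    (hK : IsPreconnected K) (hKS : K ⊆ Sᶜ) {y z : EuclideanSpace ℝ (Fin n)} (hy : y ∈ K)
    (hz : z ∈ K) (h : y ∈ enclosedRegion S) : z ∈ enclosedRegion S := by
  refine ⟨hKS hz, ?_⟩
  rw [← connectedComponentIn_eq (hK.subset_connectedComponentIn hy hKS hz)]
  exact h.2

theorem notMem_enclosedRegion_of_unbounded {n : ℕ} {S K : Set (EuclideanSpace ℝ (Fin n))}
    (hK : IsPreconnected K) (hKS : K ⊆ Sᶜ) (hKb : ¬ Bornology.IsBounded K)
    {y : EuclideanSpace ℝ (Fin n)} (hy : y ∈ K) : y ∉ enclosedRegion S :=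
  fun h => hKb (h.2.subset (hK.subset_connectedComponentIn hy hKS))

/-- Not being enclosed is stable under small perturbations of the point and of the time: a path to a
large sphere, continued by a ray, keeps avoiding the surface. -/
theorem IsEvolvingSurface.eventually_notMem_enclosedRegion {n : ℕ}
    {Γ : ℝ → Set (EuclideanSpace ℝ (Fin n))}
    (hΓ : IsEvolvingSurface Γ) {t : ℝ} (ht : 0 < t) {γ : ℝ → EuclideanSpace ℝ (Fin n)}
    (hγ : ∀ᶠ s in 𝓝 t, γ s ∈ Γ s) (hγc : ContinuousAt γ t)
    {z : EuclideanSpace ℝ (Fin n)} (hz : z ∉ Γ t ∪ enclosedRegion (Γ t)) :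
    ∀ᶠ p : EuclideanSpace ℝ (Fin n) × ℝ in 𝓝 (z, t), p.1 ∉ enclosedRegion (Γ p.2) := by
  have hzΓ : z ∈ (Γ t)ᶜ := fun h => hz (Or.inl h)
  have hΓo : IsOpen (Γ t)ᶜ := (hΓ.isCompact t ht).isClosed.isOpen_compl
  have hunb : ¬ Bornology.IsBounded (connectedComponentIn (Γ t)ᶜ z) :=
    fun h => hz (Or.inr ⟨hzΓ, h⟩)
  obtain ⟨R, hR0, hR⟩ := (hΓ.isCompact t ht).isBounded.subset_ball_lt 0 0
  obtain ⟨w, hw, hwR⟩ : ∃ w ∈ connectedComponentIn (Γ t)ᶜ z, R ≤ ‖w‖ := by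
    by_contra! hcon
    exact hunb ((Metric.isBounded_ball (x := 0) (r := R)).subset fun w hw => by
      simpa using hcon w hw)
  have hJ : JoinedIn (connectedComponentIn (Γ t)ᶜ z) z w :=
    (hΓo.connectedComponentIn.isConnected_iff_isPathConnected.1
      (isConnected_connectedComponentIn_iff.2 hzΓ)).joinedIn z (mem_connectedComponentIn hzΓ) w hw
  obtain ⟨σ, hσ⟩ := hJ
  obtain ⟨r, hr, hrΓ⟩ := Metric.nhds_basis_closedBall.mem_iff.1 (hΓo.mem_nhds hzΓ)
  set ray : Set (EuclideanSpace ℝ (Fin n)) := (fun ρ : ℝ => ρ • w) '' Ici 1 with hray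
  have hrayR : ∀ y ∈ ray, R ≤ ‖y‖ := by
    rintro _ ⟨ρ, hρ, rfl⟩
    have hρ1 : (1 : ℝ) ≤ ρ := hρ
    rw [norm_smul, Real.norm_eq_abs, abs_of_nonneg (by linarith)]
    nlinarith [norm_nonneg w]
  have hrayub : ¬ Bornology.IsBounded ray := by
    intro hb
    obtain ⟨C, hC⟩ := hb.exists_norm_le
    have hw0 : 0 < ‖w‖ := hR0.trans_le hwR
    have h1 : (1 : ℝ) ≤ |C| / ‖w‖ + 1 := by
      have : 0 ≤ |C| / ‖w‖ := by positivity
      linarith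
    have := hC _ ⟨|C| / ‖w‖ + 1, h1, rfl⟩
    rw [norm_smul, Real.norm_eq_abs, abs_of_nonneg (by linarith), add_mul,
      div_mul_cancel₀ _ hw0.ne'] at this
    linarith [le_abs_self C]
  set L : Set (EuclideanSpace ℝ (Fin n)) := (Metric.closedBall z r ∪ range σ) ∪ ray with hL
  have hLc : IsPreconnected L := by
    refine IsPreconnected.union w (Or.inr ⟨1, σ.target⟩) ⟨1, by simp, by simp⟩ ?_ ?_
    · exact IsPreconnected.union z (Metric.mem_closedBall_self hr.le) ⟨0, σ.source⟩
        (convex_closedBall z r).isPreconnected (isPreconnected_range σ.continuous)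
    · exact isPreconnected_Ici.image _ (by fun_prop)
  have hcpt : IsCompact (Metric.closedBall z r ∪ range σ) :=
    (isCompact_closedBall z r).union (isCompact_range σ.continuous)
  have hΓN : Γ t ⊆ (Metric.closedBall z r ∪ range σ)ᶜ ∩ Metric.ball 0 R := by
    refine subset_inter (fun y hy hyc => ?_) hR
    rcases hyc with hyc | ⟨τ, rfl⟩
    · exact hrΓ hyc hy
    · exact connectedComponentIn_subset _ _ (hσ τ) hy
  have hev := hΓ.eventually_subset ht hγ hγc
    (hcpt.isClosed.isOpen_compl.inter Metric.isOpen_ball) hΓN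
  have hev' := (continuous_snd.tendsto (z, t)).eventually hev
  have hball : ∀ᶠ p : EuclideanSpace ℝ (Fin n) × ℝ in 𝓝 (z, t), p.1 ∈ Metric.closedBall z r :=
    (continuous_fst.tendsto (z, t)).eventually (Metric.closedBall_mem_nhds z hr)
  filter_upwards [hev', hball] with p hp1 hp2
  refine notMem_enclosedRegion_of_unbounded hLc (fun y hy hyΓ => ?_)
    (fun hb => hrayub (hb.subset subset_union_right)) (Or.inl (Or.inl hp2))
  have := hp1 hyΓ
  rcases hy with hy | hy
  · exact this.1 hy
  · have h2 : ‖y‖ < R := by simpa using this.2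
    exact absurd (hrayR y hy) (not_le.2 h2)

/-! ### Tangent cone of a zero set -/

theorem HasFDerivAt.eventually_pos_of_apply_pos {X : Type*} [NormedAddCommGroup X]
    [NormedSpace ℝ X] {ψ : X → ℝ} {ψ' : X →L[ℝ] ℝ} {p w : X} (hψ : HasFDerivAt ψ ψ' p)
    (h0 : ψ p = 0) (hw : 0 < ψ' w) : ∀ᶠ τ : ℝ in 𝓝[>] 0, 0 < ψ (p + τ • w) := by
  have hl : HasDerivAt (fun τ : ℝ => p + τ • w) w 0 := by
    simpa using ((hasDerivAt_id (0 : ℝ)).smul_const w).const_add p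
  have hd : HasDerivAt (fun τ : ℝ => ψ (p + τ • w)) (ψ' w) 0 := by
    have hψ2 : HasFDerivAt ψ ψ' (p + (0 : ℝ) • w) := by simpa using hψ
    exact hψ2.comp_hasDerivAt 0 hl
  have := eventually_nhdsWithin_sign_eq_of_deriv_pos (f := fun τ : ℝ => ψ (p + τ • w)) (x₀ := 0)
    (by rw [hd.deriv]; exact hw) (by simpa using h0)
  filter_upwards [nhdsWithin_le_nhds this, self_mem_nhdsWithin] with τ h1 h2
  have h3 : (0 : ℝ) < τ := h2
  rw [sub_zero, sign_pos h3] at h1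
  exact sign_eq_one_iff.1 h1

/-- If `φ` vanishes on `S`, and near `p` only there, then the kernel of its nonzero differential
consists of tangent vectors of `S`. With `m` transversal to the kernel, `φ` has opposite signs at
`p + τ (v ± ε m)` for small `τ > 0`, so it has a zero between these points. -/
theorem mem_tangentConeAt_of_fderiv_eq_zero {X : Type*} [NormedAddCommGroup X] [NormedSpace ℝ X]
    {S : Set X} {p : X} {φ : X → ℝ} {φ' : X →L[ℝ] ℝ} (hφ : HasFDerivAt φ φ' p)
    (hc : ∀ᶠ q in 𝓝 p, ContinuousAt φ q) (hS : ∀ᶠ q in 𝓝 p, (q ∈ S ↔ φ q = 0)) (h0 : φ p = 0)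
    (hne : φ' ≠ 0) {v : X} (hv : φ' v = 0) : v ∈ tangentConeAt ℝ S p := by
  obtain ⟨m, hm⟩ : ∃ m, 0 < φ' m := by
    obtain ⟨m, hm⟩ : ∃ m, φ' m ≠ 0 := by
      by_contra! h
      exact hne (ContinuousLinearMap.ext h)
    rcases hm.lt_or_gt with h | h
    · exact ⟨-m, by simpa using h⟩
    · exact ⟨m, h⟩
  obtain ⟨r, hr, hrc⟩ := Metric.eventually_nhds_iff_ball.1 hc
  have key : ∀ ε : ℝ, 0 < ε → ∃ τ : ℝ, 0 < τ ∧ τ < ε ∧ ∃ θ : ℝ, |θ| ≤ ε ∧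
      φ (p + τ • (v + θ • m)) = 0 := by
    intro ε hε
    have e1 := hφ.eventually_pos_of_apply_pos (w := v + ε • m) h0 (by simp [hv]; positivity)
    have e2 := hφ.fun_neg.eventually_pos_of_apply_pos (w := v + (-ε) • m) (by simp [h0])
      (by simp [hv]; positivity)
    have e3 : ∀ᶠ τ : ℝ in 𝓝[>] 0, τ * (‖v‖ + ε * ‖m‖) < r := by
      have : Tendsto (fun τ : ℝ => τ * (‖v‖ + ε * ‖m‖)) (𝓝 0) (𝓝 (0 * (‖v‖ + ε * ‖m‖))) :=
        (continuous_id.mul continuous_const).tendsto 0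
      rw [zero_mul] at this
      exact nhdsWithin_le_nhds (this.eventually (gt_mem_nhds hr))
    have e4 : ∀ᶠ τ : ℝ in 𝓝[>] 0, τ < ε := nhdsWithin_le_nhds (gt_mem_nhds hε)
    obtain ⟨τ, h1, h2, h3, h4, h5⟩ :=
      (e1.and (e2.and (e3.and (e4.and self_mem_nhdsWithin)))).exists
    have hτ : 0 < τ := h5
    refine ⟨τ, hτ, h4, ?_⟩
    have hcont : ContinuousOn (fun θ : ℝ => φ (p + τ • (v + θ • m))) (Icc (-ε) ε) := by
      intro θ hθ
      have hmem : p + τ • (v + θ • m) ∈ Metric.ball p r := by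
        rw [mem_ball_iff_norm, add_sub_cancel_left, norm_smul, Real.norm_eq_abs, abs_of_pos hτ]
        refine lt_of_le_of_lt ?_ h3
        gcongr
        refine (norm_add_le _ _).trans ?_
        rw [norm_smul, Real.norm_eq_abs]
        gcongr
        exact abs_le.2 hθ
      have hl : ContinuousAt (fun θ : ℝ => p + τ • (v + θ • m)) θ := by fun_prop
      exact (ContinuousAt.comp (f := fun θ : ℝ => p + τ • (v + θ • m)) (hrc _ hmem)
        hl).continuousWithinAt
    obtain ⟨θ, hθ, hθ0⟩ := intermediate_value_Icc (by linarith) hcont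
      (show (0 : ℝ) ∈ _ from ⟨by linarith, h1.le⟩)
    exact ⟨θ, abs_le.2 hθ, hθ0⟩
  choose τ hτ hτε θ hθ hzero using fun k : ℕ => key (1 / ((k : ℝ) + 1)) (by positivity)
  have hlim := tendsto_one_div_add_atTop_nhds_zero_nat (𝕜 := ℝ)
  have hτ0 : Tendsto τ atTop (𝓝 0) := squeeze_zero (fun k => (hτ k).le) (fun k => (hτε k).le) hlim
  have hθ0 : Tendsto θ atTop (𝓝 0) := squeeze_zero_norm hθ hlim
  have hw : Tendsto (fun k => v + θ k • m) atTop (𝓝 v) := by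
    simpa using (hθ0.smul_const m).const_add v
  have hd : Tendsto (fun k => τ k • (v + θ k • m)) atTop (𝓝 0) := by simpa using hτ0.smul hw
  refine mem_tangentConeAt_of_seq atTop (fun k => (τ k)⁻¹) _ hd ?_ ?_
  · have hp : Tendsto (fun k => p + τ k • (v + θ k • m)) atTop (𝓝 p) := by
      simpa using hd.const_add p
    filter_upwards [hp.eventually hS] with k hk
    exact hk.2 (hzero k)
  · refine hw.congr fun k => ?_
    rw [inv_smul_smul₀ (hτ k).ne']

/-! ### Local defining functions of the space-time manifold -/

/-- The gradient of `φ` with respect to the space variable. -/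
noncomputable def spatialGradient {n : ℕ} (φ : EuclideanSpace ℝ (Fin n) × ℝ → ℝ)
    (q : EuclideanSpace ℝ (Fin n) × ℝ) : EuclideanSpace ℝ (Fin n) :=
  (InnerProductSpace.toDual ℝ _).symm (fderiv ℝ φ q ∘L ContinuousLinearMap.inl ℝ _ ℝ)

theorem inner_spatialGradient {n : ℕ} (φ : EuclideanSpace ℝ (Fin n) × ℝ → ℝ)
    (q : EuclideanSpace ℝ (Fin n) × ℝ) (w : EuclideanSpace ℝ (Fin n)) :
    inner ℝ (spatialGradient φ q) w = fderiv ℝ φ q (w, 0) := by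
  simp [spatialGradient]

theorem spatialGradient_neg {n : ℕ} (φ : EuclideanSpace ℝ (Fin n) × ℝ → ℝ)
    (q : EuclideanSpace ℝ (Fin n) × ℝ) :
    spatialGradient (-φ) q = -spatialGradient φ q := by
  refine ext_inner_right ℝ fun w => ?_
  rw [inner_neg_left, inner_spatialGradient, inner_spatialGradient, fderiv_neg]
  rfl

/-- The normalized spatial gradient `∇φ / ‖∇φ‖`, which is `0` where the gradient vanishes. -/
noncomputable def unitGradient {n : ℕ} (φ : EuclideanSpace ℝ (Fin n) × ℝ → ℝ)
    (q : EuclideanSpace ℝ (Fin n) × ℝ) : EuclideanSpace ℝ (Fin n) :=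
  ‖spatialGradient φ q‖⁻¹ • spatialGradient φ q

theorem norm_unitGradient {n : ℕ} {φ : EuclideanSpace ℝ (Fin n) × ℝ → ℝ}
    {q : EuclideanSpace ℝ (Fin n) × ℝ} (h : spatialGradient φ q ≠ 0) : ‖unitGradient φ q‖ = 1 := by
  rw [unitGradient, norm_smul, norm_inv, norm_norm, inv_mul_cancel₀ (norm_ne_zero_iff.2 h)]

/-- Near `q`, the space-time manifold is the zero set of the `C²` function `φ`, whose gradient in the
space variable alone does not vanish at `q`. The point `q` itself need not lie on the manifold, so
that the condition is open in `q`. -/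
structure IsLocalDefiningFunction {n : ℕ} (Γ : ℝ → Set (EuclideanSpace ℝ (Fin n)))
    (q : EuclideanSpace ℝ (Fin n) × ℝ) (φ : EuclideanSpace ℝ (Fin n) × ℝ → ℝ) : Prop where
  contDiffAt : ContDiffAt ℝ 2 φ q
  eventually_mem_iff : ∀ᶠ r in 𝓝 q, (r ∈ spaceTime Γ ↔ φ r = 0)
  spatialGradient_ne_zero : spatialGradient φ q ≠ 0

namespace IsLocalDefiningFunction

variable {n : ℕ} {Γ : ℝ → Set (EuclideanSpace ℝ (Fin n))}
  {q : EuclideanSpace ℝ (Fin n) × ℝ} {φ : EuclideanSpace ℝ (Fin n) × ℝ → ℝ}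

theorem neg (h : IsLocalDefiningFunction Γ q φ) : IsLocalDefiningFunction Γ q (-φ) where
  contDiffAt := h.contDiffAt.neg
  eventually_mem_iff := by simpa using h.eventually_mem_iff
  spatialGradient_ne_zero := by
    rw [spatialGradient_neg]
    exact neg_ne_zero.2 h.spatialGradient_ne_zero

theorem contDiffAt_spatialGradient (h : IsLocalDefiningFunction Γ q φ) :
    ContDiffAt ℝ 1 (spatialGradient φ) q := by
  have h1 : ContDiffAt ℝ 1 (fderiv ℝ φ) q := h.contDiffAt.fderiv_right (by norm_num)
  have h2 : ContDiffAt ℝ 1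
      (fun r => fderiv ℝ φ r ∘L ContinuousLinearMap.inl ℝ (EuclideanSpace ℝ (Fin n)) ℝ) q :=
    h1.clm_comp contDiffAt_const
  exact (InnerProductSpace.toDual ℝ
    (EuclideanSpace ℝ (Fin n))).symm.toContinuousLinearEquiv.contDiff.contDiffAt.comp q h2

theorem contDiffAt_unitGradient (h : IsLocalDefiningFunction Γ q φ) :
    ContDiffAt ℝ 1 (unitGradient φ) q :=
  ((h.contDiffAt_spatialGradient.norm ℝ h.spatialGradient_ne_zero).inv
    (norm_ne_zero_iff.2 h.spatialGradient_ne_zero)).smul h.contDiffAt_spatialGradient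

theorem eventually (h : IsLocalDefiningFunction Γ q φ) :
    ∀ᶠ r in 𝓝 q, IsLocalDefiningFunction Γ r φ := by
  filter_upwards [h.contDiffAt.eventually (by simp), h.eventually_mem_iff.eventually_nhds,
    h.contDiffAt_spatialGradient.continuousAt.eventually_ne h.spatialGradient_ne_zero]
    with r h1 h2 h3 using ⟨h1, h2, h3⟩

theorem differentiableAt (h : IsLocalDefiningFunction Γ q φ) : DifferentiableAt ℝ φ q :=
  h.contDiffAt.differentiableAt (by norm_num)

theorem apply_eq_zero (h : IsLocalDefiningFunction Γ q φ) (hq : q ∈ spaceTime Γ) : φ q = 0 :=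
  h.eventually_mem_iff.self_of_nhds.1 hq

theorem fderiv_ne_zero (h : IsLocalDefiningFunction Γ q φ) : fderiv ℝ φ q ≠ 0 := by
  intro h0
  refine h.spatialGradient_ne_zero (ext_inner_right ℝ fun w => ?_)
  rw [inner_spatialGradient, h0]
  simp

theorem mem_tangentConeAt_spaceTime (h : IsLocalDefiningFunction Γ q φ) (hq : q ∈ spaceTime Γ)
    {v : EuclideanSpace ℝ (Fin n) × ℝ} (hv : fderiv ℝ φ q v = 0) :
    v ∈ tangentConeAt ℝ (spaceTime Γ) q :=
  mem_tangentConeAt_of_fderiv_eq_zero h.differentiableAt.hasFDerivAt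
    (h.eventually.mono fun _ hr => hr.contDiffAt.continuousAt) h.eventually_mem_iff
    (h.apply_eq_zero hq) h.fderiv_ne_zero hv

/-- The time slice at `q.2` of the space-time manifold is the zero set of `φ (·, q.2)`. -/
theorem mem_tangentConeAt (h : IsLocalDefiningFunction Γ q φ) (hq : q ∈ spaceTime Γ)
    {v : EuclideanSpace ℝ (Fin n)} (hv : inner ℝ (spatialGradient φ q) v = 0) :
    v ∈ tangentConeAt ℝ (Γ q.2) q.1 := by
  have hl : Continuous fun y : EuclideanSpace ℝ (Fin n) => (y, q.2) := by fun_prop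
  have hlt : Tendsto (fun y : EuclideanSpace ℝ (Fin n) => (y, q.2)) (𝓝 q.1) (𝓝 q) :=
    hl.tendsto q.1
  have hd : HasFDerivAt (fun y => φ (y, q.2))
      (fderiv ℝ φ q ∘L ContinuousLinearMap.inl ℝ (EuclideanSpace ℝ (Fin n)) ℝ) q.1 :=
    HasFDerivAt.comp (f := fun y => (y, q.2)) q.1 h.differentiableAt.hasFDerivAt
      (hasFDerivAt_prodMk_left q.1 q.2)
  refine mem_tangentConeAt_of_fderiv_eq_zero hd ?_ ?_ (h.apply_eq_zero hq) ?_ ?_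
  · filter_upwards [hlt.eventually h.eventually] with y hy
    exact ContinuousAt.comp (f := fun y => (y, q.2)) hy.contDiffAt.continuousAt hl.continuousAt
  · filter_upwards [hlt.eventually h.eventually_mem_iff] with y hy
    rw [← hy]
    exact ⟨fun hy => ⟨hq.1, hy⟩, fun hy => hy.2⟩
  · intro h0
    refine h.spatialGradient_ne_zero ?_
    rw [spatialGradient, h0, map_zero]
  · rw [inner_spatialGradient] at hv
    simpa using hv

/-- A unit vector orthogonal to the surface is a multiple of the gradient: its component orthogonal to
the gradient is tangent to the surface, hence orthogonal to the vector itself. -/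
theorem eq_or_eq_neg_of_orthogonal (h : IsLocalDefiningFunction Γ q φ) (hq : q ∈ spaceTime Γ)
    {ν : EuclideanSpace ℝ (Fin n)} (h1 : ‖ν‖ = 1)
    (hν : ∀ v ∈ tangentConeAt ℝ (Γ q.2) q.1, inner ℝ ν v = 0) :
    ν = unitGradient φ q ∨ ν = -unitGradient φ q := by
  set m := unitGradient φ q with hm
  have hm1 : ‖m‖ = 1 := norm_unitGradient h.spatialGradient_ne_zero
  have hmm : inner ℝ m m = 1 := by rw [real_inner_self_eq_norm_sq, hm1, one_pow]
  set w := ν - (inner ℝ m ν : ℝ) • m with hw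
  have hmw : inner ℝ m w = 0 := by
    rw [hw, inner_sub_right, inner_smul_right, hmm, mul_one, sub_self]
  have hgw : inner ℝ (spatialGradient φ q) w = 0 := by
    rw [hm, unitGradient, inner_smul_left] at hmw
    simpa [h.spatialGradient_ne_zero] using hmw
  have hνw := hν w (h.mem_tangentConeAt hq hgw)
  have hw0 : w = 0 := by
    rw [← inner_self_eq_zero (𝕜 := ℝ)]
    nth_rw 1 [hw]
    rw [inner_sub_left, inner_smul_left, hνw, hmw]
    simp
  have hνm : ν = (inner ℝ m ν : ℝ) • m := sub_eq_zero.1 hw0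
  have habs : |(inner ℝ m ν : ℝ)| = 1 := by
    have := congrArg norm hνm
    rw [norm_smul, hm1, h1, mul_one, Real.norm_eq_abs] at this
    exact this.symm
  rcases eq_or_eq_neg_of_abs_eq habs with hc | hc
  · left; rw [hνm, hc, one_smul]
  · right; rw [hνm, hc, neg_one_smul]

/-- The space-time velocity of a curve moving with the surface lies in the kernel of `dφ`. The gradient
of `φ` may vanish here, as transversality is deduced from this identity. -/
theorem fderiv_curve_eq_zero {γ : ℝ → EuclideanSpace ℝ (Fin n)} {s : ℝ} (hs : 0 < s)
    (hφ : DifferentiableAt ℝ φ (γ s, s))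
    (hS : ∀ᶠ r in 𝓝 (γ s, s), (r ∈ spaceTime Γ ↔ φ r = 0))
    (hγ : ∀ᶠ s' in 𝓝 s, γ s' ∈ Γ s') (hd : DifferentiableAt ℝ γ s) :
    fderiv ℝ φ (γ s, s) (deriv γ s, 1) = 0 := by
  have hc : HasDerivAt (fun s' => (γ s', s')) (deriv γ s, 1) s :=
    hd.hasDerivAt.prodMk (hasDerivAt_id s)
  have h1 : HasDerivAt (fun s' => φ (γ s', s')) (fderiv ℝ φ (γ s, s) (deriv γ s, 1)) s :=
    HasFDerivAt.comp_hasDerivAt (f := fun s' => (γ s', s')) s hφ.hasFDerivAt hc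
  have h2 : (fun s' => φ (γ s', s')) =ᶠ[𝓝 s] fun _ => 0 := by
    filter_upwards [hc.continuousAt.eventually hS, hγ, lt_mem_nhds hs] with s' ha hb hc
    exact ha.1 ⟨hc, hb⟩
  exact h1.unique ((hasDerivAt_const s (0 : ℝ)).congr_of_eventuallyEq h2)

end IsLocalDefiningFunction

/-! ### The outward normal as a unit gradient -/

/-- A curve moving with the surface shows that the space-time manifold is not tangent to the time
slice at the point considered, so that a defining function has a nonzero spatial gradient. -/
theorem IsEvolvingSurface.exists_isLocalDefiningFunction {n : ℕ}
    {Γ : ℝ → Set (EuclideanSpace ℝ (Fin n))} (hΓ : IsEvolvingSurface Γ) {t : ℝ} (ht : 0 < t)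
    {γ : ℝ → EuclideanSpace ℝ (Fin n)} (hγ : ∀ᶠ s in 𝓝 t, γ s ∈ Γ s)
    (hd : DifferentiableAt ℝ γ t) :
    ∃ φ, IsLocalDefiningFunction Γ (γ t, t) φ := by
  obtain ⟨U, hU, hpU, φ, hφ, hne, hSU⟩ :=
    hΓ.spaceTime_hypersurface (γ t, t) ⟨ht, hγ.self_of_nhds⟩
  have hc : ContDiffAt ℝ 2 φ (γ t, t) := hφ.contDiffAt (hU.mem_nhds hpU)
  have hS : ∀ᶠ r in 𝓝 (γ t, t), (r ∈ spaceTime Γ ↔ φ r = 0) := by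
    filter_upwards [hU.mem_nhds hpU] with r hr
    have := Set.ext_iff.1 hSU r
    simpa [hr] using this
  refine ⟨φ, hc, hS, fun h0 => hne ?_⟩
  have h1 := IsLocalDefiningFunction.fderiv_curve_eq_zero ht (hc.differentiableAt (by norm_num))
    hS hγ hd
  have h2 : ∀ w, fderiv ℝ φ (γ t, t) (w, 0) = 0 := fun w => by
    rw [← inner_spatialGradient, h0, inner_zero_left]
  have h3 : fderiv ℝ φ (γ t, t) (0, 1) = 0 := by
    have h4 : ((deriv γ t, 1) : EuclideanSpace ℝ (Fin n) × ℝ) = (deriv γ t, 0) + (0, 1) := by simp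
    rwa [h4, map_add, h2, zero_add] at h1
  refine ContinuousLinearMap.ext fun v => ?_
  have h5 : v = (v.1, 0) + v.2 • ((0, 1) : EuclideanSpace ℝ (Fin n) × ℝ) := by ext <;> simp
  rw [h5, map_add, map_smul, h2, h3]
  simp

/-- If the outward normal is `m` and not `-m` at one point, with `m` the unit gradient, then it is `m`
at all nearby points of space-time. -/
theorem IsLocalDefiningFunction.eventually_eq_unitGradient {n : ℕ}
    {Γ : ℝ → Set (EuclideanSpace ℝ (Fin n))} (hΓ : IsEvolvingSurface Γ)
    {ν : EuclideanSpace ℝ (Fin n) → ℝ → EuclideanSpace ℝ (Fin n)}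
    (hν : ∀ t, 0 < t → ∀ x ∈ Γ t, IsOutwardUnitNormal (Γ t) x (ν x t))
    {t : ℝ} (ht : 0 < t) {γ : ℝ → EuclideanSpace ℝ (Fin n)}
    (hγ : ∀ᶠ s in 𝓝 t, γ s ∈ Γ s) (hγc : ContinuousAt γ t)
    {φ : EuclideanSpace ℝ (Fin n) × ℝ → ℝ} (h : IsLocalDefiningFunction Γ (γ t, t) φ)
    (h0 : ν (γ t) t = unitGradient φ (γ t, t)) :
    ∀ᶠ q in 𝓝[spaceTime Γ] (γ t, t), ν q.1 q.2 = unitGradient φ q := by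
  set x := γ t with hx
  set m₀ := unitGradient φ (x, t) with hm₀
  have hm1 : ‖m₀‖ = 1 := norm_unitGradient h.spatialGradient_ne_zero
  have hinner : ∀ {q}, IsLocalDefiningFunction Γ q φ →
      0 < inner ℝ (spatialGradient φ q) (unitGradient φ q) := by
    intro q hq
    have := norm_pos_iff.2 hq.spatialGradient_ne_zero
    rw [unitGradient, inner_smul_right, real_inner_self_eq_norm_sq]
    positivity
  have hpos : ∀ᶠ q in 𝓝 (x, t), 0 < inner ℝ (spatialGradient φ q) m₀ :=
    (h.contDiffAt_spatialGradient.continuousAt.inner continuousAt_const).eventually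
      (lt_mem_nhds (hinner h))
  obtain ⟨r, hr, hball⟩ := Metric.eventually_nhds_iff_ball.1 (h.eventually.and hpos)
  -- a fixed point `x + δ m₀` above the surface is not enclosed, nor are nearby points later or earlier
  have hδe : ∀ᶠ δ : ℝ in 𝓝[>] 0, x + δ • m₀ ∉ Γ t ∪ enclosedRegion (Γ t) := by
    rw [← h0]
    exact (hν t ht x hγ.self_of_nhds).outward_side
  have hδr : ∀ᶠ δ : ℝ in 𝓝[>] 0, δ < r / 2 := nhdsWithin_le_nhds (gt_mem_nhds (half_pos hr))
  obtain ⟨δ, hδΓ, hδr, hδ⟩ := (hδe.and (hδr.and self_mem_nhdsWithin)).exists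
  have hδ0 : (0 : ℝ) < δ := hδ
  have hev := (hΓ.eventually_notMem_enclosedRegion ht hγ hγc hδΓ).eventually_nhds
  have hsh : Continuous fun q : EuclideanSpace ℝ (Fin n) × ℝ => (q.1 + δ • m₀, q.2) := by fun_prop
  have hev' := (hsh.tendsto (x, t)).eventually hev
  filter_upwards [nhdsWithin_le_nhds hev', self_mem_nhdsWithin,
    nhdsWithin_le_nhds (Metric.ball_mem_nhds (x, t) (half_pos hr))] with q hq1 hqG hq2
  have hq := (hball q (Metric.ball_subset_ball (by linarith) hq2)).1
  obtain ⟨y, s⟩ := q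
  have hN := hν s hqG.1 y hqG.2
  refine (hq.eq_or_eq_neg_of_orthogonal hqG hN.norm_eq_one hN.orthogonal).resolve_right fun hneg => ?_
  set m := unitGradient φ (y, s) with hm
  -- if the sign has jumped, the points just above `y` are enclosed
  have hin : ∀ᶠ ε : ℝ in 𝓝[>] 0, y + ε • m ∈ enclosedRegion (Γ s) := by
    filter_upwards [hN.inward_side] with ε hε
    change ν y s = -m at hneg
    rwa [hneg, smul_neg, sub_neg_eq_add] at hε
  have hφpos := hq.differentiableAt.hasFDerivAt.eventually_pos_of_apply_pos
    (hq.apply_eq_zero hqG) (w := (m, 0)) (by rw [← inner_spatialGradient]; exact hinner hq)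
  have hline : Continuous fun ε : ℝ => y + ε • m := by fun_prop
  have hyr : y ∈ Metric.ball x (r / 2) := by
    have := (ball_prod_same x t (r / 2)).ge hq2
    exact this.1
  have hsr : s ∈ Metric.ball t (r / 2) := by
    have := (ball_prod_same x t (r / 2)).ge hq2
    exact this.2
  have hnear : ∀ᶠ ε : ℝ in 𝓝[>] 0, y + ε • m ∈ Metric.ball x (r / 2) := by
    refine nhdsWithin_le_nhds (hline.continuousAt.eventually (Metric.isOpen_ball.mem_nhds ?_))
    simpa using hyr
  have hout : ∀ᶠ ε : ℝ in 𝓝[>] 0, y + ε • m + δ • m₀ ∉ enclosedRegion (Γ s) := by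
    have hc : Continuous fun ε : ℝ => (y + ε • m + δ • m₀, s) := by fun_prop
    have := hc.tendsto 0
    simp only [zero_smul, add_zero] at this
    exact nhdsWithin_le_nhds (this.eventually hq1)
  obtain ⟨ε, h1, h2, h3, h4⟩ := (hin.and (hφpos.and (hnear.and hout))).exists
  set z := y + ε • m with hz
  -- `φ` increases along the segment from `z` to `z + δ m₀`, which therefore avoids the surface
  have hmem : ∀ τ ∈ Icc 0 δ, (z + τ • m₀, s) ∈ Metric.ball (x, t) r := by
    intro τ hτ
    rw [← ball_prod_same]
    refine ⟨?_, Metric.ball_subset_ball (by linarith) hsr⟩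
    rw [mem_ball_iff_norm] at h3 ⊢
    have : z + τ • m₀ - x = (z - x) + τ • m₀ := by abel
    rw [this]
    refine (norm_add_le _ _).trans_lt ?_
    rw [norm_smul, hm1, mul_one, Real.norm_eq_abs, abs_of_nonneg hτ.1]
    linarith [hτ.2]
  have hder : ∀ τ ∈ Icc 0 δ, HasDerivAt (fun τ : ℝ => φ (z + τ • m₀, s))
      (inner ℝ (spatialGradient φ (z + τ • m₀, s)) m₀) τ := by
    intro τ hτ
    have hl : HasDerivAt (fun τ : ℝ => (z + τ • m₀, s)) (m₀, 0) τ := by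
      have : HasDerivAt (fun τ : ℝ => z + τ • m₀) m₀ τ := by
        simpa using ((hasDerivAt_id τ).smul_const m₀).const_add z
      exact this.prodMk (hasDerivAt_const τ s)
    rw [inner_spatialGradient]
    exact HasFDerivAt.comp_hasDerivAt (f := fun τ : ℝ => (z + τ • m₀, s)) τ
      (hball _ (hmem τ hτ)).1.differentiableAt.hasFDerivAt hl
  have hmono : MonotoneOn (fun τ : ℝ => φ (z + τ • m₀, s)) (Icc 0 δ) := by
    refine monotoneOn_of_deriv_nonneg (convex_Icc 0 δ)
      (fun τ hτ => (hder τ hτ).continuousAt.continuousWithinAt)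
      (fun τ hτ => (hder τ (interior_subset hτ)).differentiableAt.differentiableWithinAt) ?_
    intro τ hτ
    rw [(hder τ (interior_subset hτ)).deriv]
    exact (hball _ (hmem τ (interior_subset hτ))).2.le
  have hsub : (fun τ : ℝ => z + τ • m₀) '' Icc 0 δ ⊆ (Γ s)ᶜ := by
    rintro _ ⟨τ, hτ, rfl⟩ hΓs
    have h5 := (hball _ (hmem τ hτ)).1.apply_eq_zero ⟨hqG.1, hΓs⟩
    have h6 : φ (z + (0 : ℝ) • m₀, s) ≤ φ (z + τ • m₀, s) :=
      hmono ⟨le_rfl, hδ0.le⟩ hτ hτ.1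
    rw [h5, zero_smul, add_zero] at h6
    have h7 : 0 < φ (z, s) := by simpa [hz] using h2
    linarith
  exact h4 (mem_enclosedRegion_of_isPreconnected
    (isPreconnected_Icc.image _ (by fun_prop)) hsub ⟨0, ⟨le_rfl, hδ0.le⟩, by simp⟩
    ⟨δ, ⟨hδ0.le, le_rfl⟩, rfl⟩ h1)

theorem IsEvolvingSurface.exists_unitGradient_eq {n : ℕ}
    {Γ : ℝ → Set (EuclideanSpace ℝ (Fin n))} (hΓ : IsEvolvingSurface Γ)
    {ν : EuclideanSpace ℝ (Fin n) → ℝ → EuclideanSpace ℝ (Fin n)}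
    (hν : ∀ t, 0 < t → ∀ x ∈ Γ t, IsOutwardUnitNormal (Γ t) x (ν x t))
    {t : ℝ} (ht : 0 < t) {γ : ℝ → EuclideanSpace ℝ (Fin n)}
    (hγ : ∀ᶠ s in 𝓝 t, γ s ∈ Γ s) (hd : DifferentiableAt ℝ γ t) :
    ∃ φ, IsLocalDefiningFunction Γ (γ t, t) φ ∧
      ∀ᶠ q in 𝓝[spaceTime Γ] (γ t, t), ν q.1 q.2 = unitGradient φ q := by
  obtain ⟨φ, hφ⟩ := hΓ.exists_isLocalDefiningFunction ht hγ hd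
  have hN := hν t ht _ hγ.self_of_nhds
  rcases hφ.eq_or_eq_neg_of_orthogonal ⟨ht, hγ.self_of_nhds⟩ hN.norm_eq_one hN.orthogonal
    with h | h
  · exact ⟨φ, hφ, hφ.eventually_eq_unitGradient hΓ hν ht hγ hd.continuousAt h⟩
  · refine ⟨-φ, hφ.neg, hφ.neg.eventually_eq_unitGradient hΓ hν ht hγ hd.continuousAt ?_⟩
    rw [h, unitGradient, unitGradient, spatialGradient_neg, norm_neg, smul_neg]

/-! ### Independence of the extension -/

/-- Extensions of the same function have the same derivative in tangential directions. -/
theorem IsExtensionAt.eqOn_tangentConeAt {X W : Type*} [NormedAddCommGroup X] [NormedSpace ℝ X]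
    [NormedAddCommGroup W] [NormedSpace ℝ W] {S : Set X} {f F G : X → W} {p : X} (hp : p ∈ S)
    (hF : IsExtensionAt S f p F) (hG : IsExtensionAt S f p G) :
    EqOn (fderiv ℝ F p) (fderiv ℝ G p) (tangentConeAt ℝ S p) := by
  have h : F =ᶠ[𝓝[S] p] G := by
    filter_upwards [hF.2, hG.2] with q h1 h2 using h1.trans h2.symm
  exact hF.1.hasFDerivAt.hasFDerivWithinAt.unique_on
    (hG.1.hasFDerivAt.hasFDerivWithinAt.congr_of_eventuallyEq h (h.self_of_nhdsWithin hp))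

theorem ambientMaterialDeriv_eq_fderiv {n : ℕ} {W : Type*} [NormedAddCommGroup W]
    [NormedSpace ℝ W] (u : EuclideanSpace ℝ (Fin n) → ℝ → EuclideanSpace ℝ (Fin n))
    {F : EuclideanSpace ℝ (Fin n) × ℝ → W} {x : EuclideanSpace ℝ (Fin n)} {t : ℝ}
    (hF : DifferentiableAt ℝ F (x, t)) :
    ambientMaterialDeriv u F x t = fderiv ℝ F (x, t) (u x t, 1) := by
  have h1 : HasDerivAt (fun s => F (x, s)) (fderiv ℝ F (x, t) (0, 1)) t :=
    HasFDerivAt.comp_hasDerivAt (f := fun s => (x, s)) t hF.hasFDerivAt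
      ((hasDerivAt_const t x).prodMk (hasDerivAt_id t))
  have h2 : HasFDerivAt (fun y => F (y, t))
      (fderiv ℝ F (x, t) ∘L ContinuousLinearMap.inl ℝ (EuclideanSpace ℝ (Fin n)) ℝ) x :=
    HasFDerivAt.comp (f := fun y => (y, t)) x hF.hasFDerivAt (hasFDerivAt_prodMk_left x t)
  rw [ambientMaterialDeriv, h1.deriv, h2.fderiv, ContinuousLinearMap.comp_apply,
    ContinuousLinearMap.inl_apply, ← map_add]
  simp

theorem IsExtensionAt.hasMaterialDeriv {n : ℕ} {W : Type*} [NormedAddCommGroup W]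
    [NormedSpace ℝ W] {Γ : ℝ → Set (EuclideanSpace ℝ (Fin n))}
    {u : EuclideanSpace ℝ (Fin n) → ℝ → EuclideanSpace ℝ (Fin n)}
    {f : EuclideanSpace ℝ (Fin n) → ℝ → W} {x : EuclideanSpace ℝ (Fin n)} {t : ℝ}
    {G : EuclideanSpace ℝ (Fin n) × ℝ → W} (hx : (x, t) ∈ spaceTime Γ)
    (hG : IsExtensionAt (spaceTime Γ) (fun p => f p.1 p.2) (x, t) G)
    (hu : (u x t, 1) ∈ tangentConeAt ℝ (spaceTime Γ) (x, t)) :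
    HasMaterialDeriv Γ u f x t (fderiv ℝ G (x, t) (u x t, 1)) :=
  ⟨⟨G, hG⟩, fun _ hF => by
    rw [ambientMaterialDeriv_eq_fderiv u hF.1]
    exact hF.eqOn_tangentConeAt hx hG hu⟩

section NormalProjector

variable {n : ℕ} {ν : EuclideanSpace ℝ (Fin n)}

theorem normalProjector_apply (ν w : EuclideanSpace ℝ (Fin n)) :
    normalProjector ν w = w - (inner ℝ ν w : ℝ) • ν := by
  simp [normalProjector]

theorem inner_normalProjector_left (ν v w : EuclideanSpace ℝ (Fin n)) :
    inner ℝ (normalProjector ν v) w = inner ℝ v (normalProjector ν w) := by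
  simp only [normalProjector_apply, inner_sub_left, inner_sub_right, inner_smul_left,
    inner_smul_right, real_inner_comm, RCLike.conj_to_real]
  ring

theorem inner_self_normalProjector (hν : ‖ν‖ = 1) (w : EuclideanSpace ℝ (Fin n)) :
    inner ℝ ν (normalProjector ν w) = 0 := by
  rw [normalProjector_apply, inner_sub_right, inner_smul_right, real_inner_self_eq_norm_sq, hν]
  ring

theorem normalProjector_of_orthogonal {w : EuclideanSpace ℝ (Fin n)} (h : inner ℝ ν w = 0) :
    normalProjector ν w = w := by
  rw [normalProjector_apply, h, zero_smul, sub_zero]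

theorem IsExtensionAt.hasCovariantDeriv {S : Set (EuclideanSpace ℝ (Fin n))}
    {f G : EuclideanSpace ℝ (Fin n) → EuclideanSpace ℝ (Fin n)} {x : EuclideanSpace ℝ (Fin n)}
    (hx : x ∈ S) (hG : IsExtensionAt S f x G)
    (hS : ∀ v, normalProjector ν v ∈ tangentConeAt ℝ S x) :
    HasCovariantDeriv S f x ν (normalProjector ν ∘L fderiv ℝ G x ∘L normalProjector ν) :=
  ⟨⟨G, hG⟩, fun _ hF => ContinuousLinearMap.ext fun v =>
    congrArg (normalProjector ν) (hF.eqOn_tangentConeAt hx hG (hS v))⟩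

theorem inner_normalProjector_gradient (F : EuclideanSpace ℝ (Fin n) → ℝ)
    (ν x w : EuclideanSpace ℝ (Fin n)) :
    inner ℝ (normalProjector ν (gradient F x)) w = fderiv ℝ F x (normalProjector ν w) := by
  rw [inner_normalProjector_left, gradient, InnerProductSpace.toDual_symm_apply]

theorem IsExtensionAt.hasTangentialGradient {S : Set (EuclideanSpace ℝ (Fin n))}
    {f G : EuclideanSpace ℝ (Fin n) → ℝ} {x : EuclideanSpace ℝ (Fin n)}
    (hx : x ∈ S) (hG : IsExtensionAt S f x G)
    (hS : ∀ v, normalProjector ν v ∈ tangentConeAt ℝ S x) :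
    HasTangentialGradient S f x ν (normalProjector ν (gradient G x)) :=
  ⟨⟨G, hG⟩, fun F hF => ext_inner_right ℝ fun w => by
    rw [inner_normalProjector_gradient, inner_normalProjector_gradient]
    exact hF.eqOn_tangentConeAt hx hG (hS w)⟩

theorem differentiableAt_normalProjector {X : Type*} [NormedAddCommGroup X] [NormedSpace ℝ X]
    {m : X → EuclideanSpace ℝ (Fin n)} {p : X} (hm : DifferentiableAt ℝ m p) :
    DifferentiableAt ℝ (fun q => normalProjector (m q)) p := by
  have h1 : DifferentiableAt ℝ (fun q => innerSL ℝ (m q)) p :=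
    (innerSL ℝ).differentiableAt.comp p hm
  let B := ContinuousLinearMap.smulRightL ℝ (EuclideanSpace ℝ (Fin n)) (EuclideanSpace ℝ (Fin n))
  exact ((B.isBoundedBilinearMap.differentiableAt (innerSL ℝ (m p), m p)).comp p
    (h1.prodMk hm)).const_sub _

theorem fderiv_normalProjector_apply {X : Type*} [NormedAddCommGroup X] [NormedSpace ℝ X]
    {m : X → EuclideanSpace ℝ (Fin n)} {m' : X →L[ℝ] EuclideanSpace ℝ (Fin n)} {p : X}
    (hm : HasFDerivAt m m' p) (v : X) (w : EuclideanSpace ℝ (Fin n)) :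
    fderiv ℝ (fun q => normalProjector (m q)) p v w =
      -((inner ℝ (m' v) w : ℝ) • m p + (inner ℝ (m p) w : ℝ) • m' v) := by
  have h1 : HasFDerivAt (fun q => normalProjector (m q) w)
      ((fderiv ℝ (fun q => normalProjector (m q)) p).flip w) p := by
    simpa using (differentiableAt_normalProjector hm.differentiableAt).hasFDerivAt.clm_apply
      (hasFDerivAt_const w p)
  have h2 : HasFDerivAt (fun q => w - (inner ℝ (m q) w : ℝ) • m q) _ p :=
    ((hm.inner ℝ (hasFDerivAt_const w p)).smul hm).const_sub w
  have h3 := congrArg (fun L => L v) (h1.unique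
    (h2.congr_of_eventuallyEq (Eventually.of_forall fun q => normalProjector_apply (m q) w)))
  simp at h3
  rw [h3]
  abel

end NormalProjector

/-! ### Derivatives of the unit gradient -/

namespace IsLocalDefiningFunction

variable {n : ℕ} {Γ : ℝ → Set (EuclideanSpace ℝ (Fin n))}
  {q : EuclideanSpace ℝ (Fin n) × ℝ} {φ : EuclideanSpace ℝ (Fin n) × ℝ → ℝ}

theorem norm_smul_unitGradient (h : IsLocalDefiningFunction Γ q φ) :
    ‖spatialGradient φ q‖ • unitGradient φ q = spatialGradient φ q := by
  rw [unitGradient, smul_inv_smul₀ (norm_ne_zero_iff.2 h.spatialGradient_ne_zero)]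

theorem hasFDerivAt_unitGradient (h : IsLocalDefiningFunction Γ q φ) :
    HasFDerivAt (unitGradient φ) (fderiv ℝ (unitGradient φ) q) q :=
  (h.contDiffAt_unitGradient.differentiableAt (by norm_num)).hasFDerivAt

theorem inner_unitGradient_fderiv (h : IsLocalDefiningFunction Γ q φ)
    (v : EuclideanSpace ℝ (Fin n) × ℝ) :
    inner ℝ (unitGradient φ q) (fderiv ℝ (unitGradient φ) q v) = 0 := by
  have h1 := h.hasFDerivAt_unitGradient.inner ℝ h.hasFDerivAt_unitGradient
  have h2 : (fun r => (inner ℝ (unitGradient φ r) (unitGradient φ r) : ℝ)) =ᶠ[𝓝 q] fun _ => 1 := by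
    filter_upwards [h.eventually] with r hr
    rw [real_inner_self_eq_norm_sq, norm_unitGradient hr.spatialGradient_ne_zero, one_pow]
  have h3 := congrArg (fun L => L v)
    (h1.unique ((hasFDerivAt_const (1 : ℝ) q).congr_of_eventuallyEq h2))
  have h4 : inner ℝ (unitGradient φ q) (fderiv ℝ (unitGradient φ) q v) +
    inner ℝ (fderiv ℝ (unitGradient φ) q v) (unitGradient φ q) = 0 := by simpa using h3
  rw [real_inner_comm (unitGradient φ q)] at h4
  linarith

theorem hasFDerivAt_fderiv (h : IsLocalDefiningFunction Γ q φ) :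
    HasFDerivAt (fderiv ℝ φ) (fderiv ℝ (fderiv ℝ φ) q) q :=
  ((h.contDiffAt.fderiv_right (m := 1) (by norm_num)).differentiableAt (by norm_num)).hasFDerivAt

/-- Tangentially, the derivative of `∇φ / ‖∇φ‖` is that of `∇φ` divided by `‖∇φ‖`, because
the derivative of the factor `1 / ‖∇φ‖` contributes a normal vector. -/
theorem norm_mul_inner_fderiv_unitGradient (h : IsLocalDefiningFunction Γ q φ)
    (v : EuclideanSpace ℝ (Fin n) × ℝ) {w : EuclideanSpace ℝ (Fin n)}
    (hw : inner ℝ (unitGradient φ q) w = 0) :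
    ‖spatialGradient φ q‖ * inner ℝ (fderiv ℝ (unitGradient φ) q v) w =
      fderiv ℝ (fderiv ℝ φ) q v (w, 0) := by
  have hn : DifferentiableAt ℝ (fun r => ‖spatialGradient φ r‖) q :=
    (h.contDiffAt_spatialGradient.norm ℝ h.spatialGradient_ne_zero).differentiableAt (by norm_num)
  have h1 := hn.hasFDerivAt.mul
    (h.hasFDerivAt_unitGradient.inner ℝ (hasFDerivAt_const w q))
  have h2 : (fun r => ‖spatialGradient φ r‖ * (inner ℝ (unitGradient φ r) w : ℝ)) =ᶠ[𝓝 q]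
      fun r => fderiv ℝ φ r (w, 0) := by
    filter_upwards [h.eventually] with r hr
    rw [← inner_spatialGradient, ← real_inner_smul_left, hr.norm_smul_unitGradient]
  have h3 := h.hasFDerivAt_fderiv.clm_apply (hasFDerivAt_const (w, (0 : ℝ)) q)
  have h4 := congrArg (fun L => L v) (h1.unique (h3.congr_of_eventuallyEq h2))
  simpa [hw] using h4

/-- The Weingarten map is symmetric. -/
theorem inner_fderiv_unitGradient_comm (h : IsLocalDefiningFunction Γ q φ)
    {v w : EuclideanSpace ℝ (Fin n)} (hv : inner ℝ (unitGradient φ q) v = 0)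
    (hw : inner ℝ (unitGradient φ q) w = 0) :
    inner ℝ (fderiv ℝ (unitGradient φ) q (v, 0)) w =
      inner ℝ (fderiv ℝ (unitGradient φ) q (w, 0)) v := by
  have hsymm : IsSymmSndFDerivAt ℝ φ q := h.contDiffAt.isSymmSndFDerivAt (by simp)
  have h1 := h.norm_mul_inner_fderiv_unitGradient (v, 0) hw
  have h2 := h.norm_mul_inner_fderiv_unitGradient (w, 0) hv
  rw [hsymm.eq, ← h2] at h1
  exact mul_left_cancel₀ (norm_ne_zero_iff.2 h.spatialGradient_ne_zero) h1

end IsLocalDefiningFunction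

/-- The velocity `v` differs by a tangent vector from that of a curve moving with the surface, so
`(v, 1)` is tangent to the space-time manifold. -/
theorem HasNormalVelocity.fderiv_eq_zero {n : ℕ} {Γ : ℝ → Set (EuclideanSpace ℝ (Fin n))}
    {x : EuclideanSpace ℝ (Fin n)} {t : ℝ} (ht : 0 < t)
    {φ : EuclideanSpace ℝ (Fin n) × ℝ → ℝ} (h : IsLocalDefiningFunction Γ (x, t) φ)
    {v ν : EuclideanSpace ℝ (Fin n)} (hν : ν = unitGradient φ (x, t))
    (hV : HasNormalVelocity Γ x t ν (inner ℝ v ν)) : fderiv ℝ φ (x, t) (v, 1) = 0 := by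
  obtain ⟨γ, rfl, hγ, hd, hVγ⟩ := hV
  have h1 := IsLocalDefiningFunction.fderiv_curve_eq_zero ht h.differentiableAt
    h.eventually_mem_iff hγ hd
  have h2 : inner ℝ (spatialGradient φ (γ t, t)) (v - deriv γ t) = 0 := by
    rw [← h.norm_smul_unitGradient, ← hν, real_inner_smul_left, inner_sub_right,
      real_inner_comm v, real_inner_comm (deriv γ t), hVγ, sub_self, mul_zero]
  rw [inner_spatialGradient] at h2
  have h3 : ((v, 1) : EuclideanSpace ℝ (Fin n) × ℝ) = (v - deriv γ t, 0) + (deriv γ t, 1) := by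
    simp
  rw [h3, map_add, h1, h2, add_zero]

/-- The tangential part of the material derivative of the unit normal. Only derivatives of the velocity
in the space variable occur, since the tangency condition `hflow` is differentiated within the time
slice. -/
theorem IsLocalDefiningFunction.inner_fderiv_unitGradient_velocity {n : ℕ}
    {Γ : ℝ → Set (EuclideanSpace ℝ (Fin n))} {x : EuclideanSpace ℝ (Fin n)} {t : ℝ}
    {φ : EuclideanSpace ℝ (Fin n) × ℝ → ℝ} (h : IsLocalDefiningFunction Γ (x, t) φ)
    (hx : (x, t) ∈ spaceTime Γ)
    {v : EuclideanSpace ℝ (Fin n) → EuclideanSpace ℝ (Fin n)} (hv : DifferentiableAt ℝ v x)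
    (hflow : ∀ᶠ y in 𝓝[Γ t] x, fderiv ℝ φ (y, t) (v y, 1) = 0)
    {w : EuclideanSpace ℝ (Fin n)} (hw : inner ℝ (unitGradient φ (x, t)) w = 0) :
    inner ℝ (fderiv ℝ (unitGradient φ) (x, t) (v x, 1)) w =
      -inner ℝ (unitGradient φ (x, t)) (fderiv ℝ v x w) := by
  set g := spatialGradient φ (x, t) with hg
  have hg0 : ‖g‖ ≠ 0 := norm_ne_zero_iff.2 h.spatialGradient_ne_zero
  have hgw : inner ℝ g w = 0 := by
    rw [hg, ← h.norm_smul_unitGradient, real_inner_smul_left, hw, mul_zero]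
  have hD : HasFDerivAt (fun y => fderiv ℝ φ (y, t))
      (fderiv ℝ (fderiv ℝ φ) (x, t) ∘L
        ContinuousLinearMap.inl ℝ (EuclideanSpace ℝ (Fin n)) ℝ) x :=
    HasFDerivAt.comp (f := fun y => (y, t)) x h.hasFDerivAt_fderiv (hasFDerivAt_prodMk_left x t)
  have hΨ := hD.clm_apply (hv.hasFDerivAt.prodMk (hasFDerivAt_const (1 : ℝ) x))
  -- the identity `hflow` holds on the surface, so it may be differentiated tangentially
  have hzero := IsExtensionAt.eqOn_tangentConeAt (S := Γ t) (f := fun _ => (0 : ℝ)) hx.2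
    ⟨hΨ.differentiableAt, hflow⟩ ⟨differentiableAt_const (0 : ℝ), Eventually.of_forall fun _ => rfl⟩
    (h.mem_tangentConeAt hx hgw)
  rw [hΨ.fderiv] at hzero
  have hsymm : IsSymmSndFDerivAt ℝ φ (x, t) := h.contDiffAt.isSymmSndFDerivAt (by simp)
  have h1 : fderiv ℝ φ (x, t) (fderiv ℝ v x w, 0) +
      fderiv ℝ (fderiv ℝ φ) (x, t) (w, 0) (v x, 1) = 0 := by simpa using hzero
  rw [hsymm.eq, ← h.norm_mul_inner_fderiv_unitGradient _ hw, ← inner_spatialGradient, ← hg] at h1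
  have h2 : inner ℝ g (fderiv ℝ v x w) =
      ‖g‖ * inner ℝ (unitGradient φ (x, t)) (fderiv ℝ v x w) := by
    rw [← real_inner_smul_left, hg, h.norm_smul_unitGradient]
  rw [h2, ← mul_add] at h1
  have := (mul_eq_zero.1 h1).resolve_left hg0
  linarith

/-! ### Material derivatives of the normal and of the projector -/

theorem lemma2p2 {n : ℕ} (hn : 3 ≤ n)
    (Γ : ℝ → Set (EuclideanSpace ℝ (Fin n))) (hΓ : IsEvolvingSurface Γ)
    -- the outward unit normal field
    (ν : EuclideanSpace ℝ (Fin n) → ℝ → EuclideanSpace ℝ (Fin n))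
    (hν : ∀ t, 0 < t → ∀ x ∈ Γ t, IsOutwardUnitNormal (Γ t) x (ν x t))
    -- the velocity field, whose normal component is the normal velocity of the surface
    (u : EuclideanSpace ℝ (Fin n) → ℝ → EuclideanSpace ℝ (Fin n))
    (hu : ∀ t, 0 < t → ∀ x ∈ Γ t, DifferentiableAt ℝ (fun y => u y t) x)
    (hV : ∀ t, 0 < t → ∀ x ∈ Γ t, HasNormalVelocity Γ x t (ν x t) (inner ℝ (u x t) (ν x t)))
    (t : ℝ) (ht : 0 < t) (x : EuclideanSpace ℝ (Fin n)) (hx : x ∈ Γ t) :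
    let P := normalProjector (ν x t)
    let I := ContinuousLinearMap.id ℝ (EuclideanSpace ℝ (Fin n))
    let gradu := fderiv ℝ (fun y => u y t) x
    let graduT := ContinuousLinearMap.adjoint gradu
    -- `H` is the Weingarten map `∇_Γ ν`, and `a` is `∇_Γᵀ u_N`
    ∃ (H : EuclideanSpace ℝ (Fin n) →L[ℝ] EuclideanSpace ℝ (Fin n))
      (a : EuclideanSpace ℝ (Fin n)),
      HasCovariantDeriv (Γ t) (fun y => ν y t) x (ν x t) H ∧
      HasTangentialGradient (Γ t) (fun y => inner ℝ (u y t) (ν y t)) x (ν x t) a ∧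
      HasMaterialDeriv Γ u ν x t (H (P (u x t)) - a) ∧
      H (P (u x t)) - a = -P (graduT (ν x t)) ∧
      HasMaterialDeriv Γ u (fun y s => normalProjector (ν y s)) x t
        (P ∘L graduT ∘L (I - P) + (I - P) ∘L gradu ∘L P) := by
  intro P I gradu graduT
  have hxt : (x, t) ∈ spaceTime Γ := ⟨ht, hx⟩
  obtain ⟨φ, hφ, hνφ⟩ : ∃ φ, IsLocalDefiningFunction Γ (x, t) φ ∧
      ∀ᶠ q in 𝓝[spaceTime Γ] (x, t), ν q.1 q.2 = unitGradient φ q := by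
    obtain ⟨γ, rfl, hγ, hd, -⟩ := hV t ht x hx
    exact hΓ.exists_unitGradient_eq hν ht hγ hd
  have hνx : ν x t = unitGradient φ (x, t) := hνφ.self_of_nhdsWithin hxt
  have hν1 : ‖ν x t‖ = 1 := (hν t ht x hx).norm_eq_one
  -- restriction of the local data to the time slice
  have hslice : Tendsto (fun y : EuclideanSpace ℝ (Fin n) => (y, t)) (𝓝[Γ t] x)
      (𝓝[spaceTime Γ] (x, t)) := by
    refine tendsto_nhdsWithin_iff.2 ⟨?_, ?_⟩
    · have : Continuous fun y : EuclideanSpace ℝ (Fin n) => (y, t) := by fun_prop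
      exact (this.tendsto x).mono_left nhdsWithin_le_nhds
    · filter_upwards [self_mem_nhdsWithin] with y hy using ⟨ht, hy⟩
  have hνφt : ∀ᶠ y in 𝓝[Γ t] x, ν y t = unitGradient φ (y, t) := hslice.eventually hνφ
  have hflow : ∀ᶠ y in 𝓝[Γ t] x, fderiv ℝ φ (y, t) (u y t, 1) = 0 := by
    filter_upwards [hνφt, self_mem_nhdsWithin,
      hslice.eventually (nhdsWithin_le_nhds hφ.eventually)] with y h1 h2 h3
    exact (hV t ht y h2).fderiv_eq_zero ht h3 h1
  have hu_tan : (u x t, 1) ∈ tangentConeAt ℝ (spaceTime Γ) (x, t) :=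
    hφ.mem_tangentConeAt_spaceTime hxt (hflow.self_of_nhdsWithin hx)
  have hm_P : ∀ w, inner ℝ (unitGradient φ (x, t)) (P w) = 0 := fun w => by
    rw [← hνx]
    exact inner_self_normalProjector hν1 w
  have hP_tan : ∀ w, P w ∈ tangentConeAt ℝ (Γ t) x := fun w => by
    refine hφ.mem_tangentConeAt hxt ?_
    rw [← hφ.norm_smul_unitGradient, real_inner_smul_left, hm_P, mul_zero]
  set D := fderiv ℝ (unitGradient φ) (x, t) with hD
  have hm : HasFDerivAt (unitGradient φ) D (x, t) := hφ.hasFDerivAt_unitGradient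
  have hmt : HasFDerivAt (fun y => unitGradient φ (y, t))
      (D ∘L ContinuousLinearMap.inl ℝ (EuclideanSpace ℝ (Fin n)) ℝ) x :=
    HasFDerivAt.comp (f := fun y => (y, t)) x hm (hasFDerivAt_prodMk_left x t)
  have huN := ((hu t ht x hx).hasFDerivAt).inner ℝ hmt
  have hext_m : IsExtensionAt (Γ t) (fun y => ν y t) x (fun y => unitGradient φ (y, t)) :=
    ⟨hmt.differentiableAt, hνφt.mono fun _ h => h.symm⟩
  have hext_uN : IsExtensionAt (Γ t) (fun y => (inner ℝ (u y t) (ν y t) : ℝ)) x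
      (fun y => inner ℝ (u y t) (unitGradient φ (y, t))) :=
    ⟨huN.differentiableAt, hνφt.mono fun _ h => by simp only [h]⟩
  have hext_mt : IsExtensionAt (spaceTime Γ) (fun p => ν p.1 p.2) (x, t) (unitGradient φ) :=
    ⟨hm.differentiableAt, hνφ.mono fun _ h => h.symm⟩
  have hext_P : IsExtensionAt (spaceTime Γ) (fun p => normalProjector (ν p.1 p.2)) (x, t)
      (fun q => normalProjector (unitGradient φ q)) :=
    ⟨differentiableAt_normalProjector hm.differentiableAt, hνφ.mono fun _ h => by simp only [h]⟩
  have hDP : ∀ v, P (D v) = D v := fun v => by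
    refine normalProjector_of_orthogonal ?_
    rw [hνx]
    exact hφ.inner_unitGradient_fderiv v
  have hPadj : ∀ v w, inner ℝ (P v) w = inner ℝ v (P w) := inner_normalProjector_left _
  have hformula : D (u x t, 1) = -P (graduT (ν x t)) := by
    refine ext_inner_right ℝ fun w => ?_
    rw [← hDP, hPadj, hφ.inner_fderiv_unitGradient_velocity hxt (hu t ht x hx) hflow (hm_P w),
      inner_neg_left, hPadj, ContinuousLinearMap.adjoint_inner_left, hνx]
  have hweingarten : (P ∘L fderiv ℝ (fun y => unitGradient φ (y, t)) x ∘L P) (P (u x t)) -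
      P (gradient (fun y => (inner ℝ (u y t) (unitGradient φ (y, t)) : ℝ)) x) =
      -P (graduT (ν x t)) := by
    have hPP : P (P (u x t)) = P (u x t) := by
      refine normalProjector_of_orthogonal ?_
      rw [hνx]
      exact hm_P _
    refine ext_inner_right ℝ fun w => ?_
    have h1 : inner ℝ (P (gradient (fun y => (inner ℝ (u y t) (unitGradient φ (y, t)) : ℝ)) x)) w =
        inner ℝ (u x t) (D (P w, 0)) + inner ℝ (gradu (P w)) (ν x t) := by
      rw [inner_normalProjector_gradient, huN.fderiv, hνx]
      simp [gradu, P, hνx]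
    rw [inner_sub_left, h1, hmt.fderiv, ContinuousLinearMap.comp_apply,
      ContinuousLinearMap.comp_apply, hPP, ContinuousLinearMap.comp_apply,
      ContinuousLinearMap.inl_apply, hPadj, hφ.inner_fderiv_unitGradient_comm (hm_P _) (hm_P _),
      ← hD, ← hPadj, hDP, inner_neg_left, hPadj, ContinuousLinearMap.adjoint_inner_left,
      real_inner_comm (u x t), real_inner_comm (ν x t)]
    ring
  refine ⟨_, _, hext_m.hasCovariantDeriv hx hP_tan, hext_uN.hasTangentialGradient hx hP_tan,
    ?_, hweingarten, ?_⟩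
  · have := hext_mt.hasMaterialDeriv hxt hu_tan
    rw [← hD, hformula, ← hweingarten] at this
    exact this
  · have := hext_P.hasMaterialDeriv (f := fun y s => normalProjector (ν y s)) hxt hu_tan
    convert this using 1
    refine ContinuousLinearMap.ext fun w => ?_
    rw [fderiv_normalProjector_apply hm, hformula, ← hνx]
    have h1 : ∀ v, (I - P) v = (inner ℝ (ν x t) v : ℝ) • ν x t := fun v => by
      simp [I, P, normalProjector_apply]
    rw [add_apply]
    simp only [ContinuousLinearMap.comp_apply, h1, map_smul]
    rw [inner_neg_left, hPadj, ContinuousLinearMap.adjoint_inner_left]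
    simp only [neg_smul, smul_neg, neg_add_rev, neg_neg]
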